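/- A numeral system is an infinite sequence $d=(d_0,d_1,d_2,\dots)$ of pairwise different closed $\beta\eta$-normal terms of the pure untyped $\lambda$-calculus (terms being identified up to renaming of bound variables). A total function $\varphi:\mathbb{N}^p\to\mathbb{N}$ is $\lambda$-definable with respect to $d$ if there is a $\lambda$-term $F$ such that $F\,d_{n_1}\cdots d_{n_p}$ is $\beta$-equivalent to $d_{\varphi(n_1,\dots,n_p)}$ for all $n_1,\dots,n_p\in\mathbb{N}$. Theorem. There is a binary total function $k:\mathbb{N}^2\to\mathbb{N}$, namely the function given by $k(n,0)=n+1$ and $k(n,m)=|n-m|$ for $m\neq 0$, such that for every numeral system $d$: $k$ is $\lambda$-definable with respect to $d$ if and only if all total recursive functions $\mathbb{N}^p\to\mathbb{N}$ (of every arity $p$) are $\lambda$-definable with respect to $d$. -/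

import Mathlib

/-- Pure untyped `λ`-terms up to renaming of bound variables, in de Bruijn notation: in `lam M` the
index `0` of `M` is the bound variable, and the index `i + 1` stands for the outer index `i`. -/
inductive LTerm : Type
  | var : ℕ → LTerm
  | app : LTerm → LTerm → LTerm
  | lam : LTerm → LTerm

namespace LTerm

/-- The renaming under a binder: `0` is kept, the other indices are renamed by `ξ`. -/
def liftRen (ξ : ℕ → ℕ) : ℕ → ℕ
  | 0 => 0
  | i + 1 => ξ i + 1

/-- Renaming of the free variables. -/
def rename : (ℕ → ℕ) → LTerm → LTerm
  | ξ, var i => var (ξ i)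
  | ξ, app M N => app (rename ξ M) (rename ξ N)
  | ξ, lam M => lam (rename (liftRen ξ) M)

/-- The substitution under a binder. -/
def liftSubst (σ : ℕ → LTerm) : ℕ → LTerm
  | 0 => var 0
  | i + 1 => rename Nat.succ (σ i)

/-- Simultaneous capture-avoiding substitution for the free variables. -/
def subst : (ℕ → LTerm) → LTerm → LTerm
  | σ, var i => σ i
  | σ, app M N => app (subst σ M) (subst σ N)
  | σ, lam M => lam (subst (liftSubst σ) M)

/-- The substitution that replaces the index `0` by `N` and lowers the other indices by one. -/
def instSubst (N : LTerm) : ℕ → LTerm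
  | 0 => N
  | i + 1 => var i

/-- `inst M N` is the contractum of the `β`-redex `(λ M) N`. -/
def inst (M N : LTerm) : LTerm := subst (instSubst N) M

/-- The variable with index `i` occurs free in the term. -/
def FreeIn : ℕ → LTerm → Prop
  | i, var j => j = i
  | i, app M N => FreeIn i M ∨ FreeIn i N
  | i, lam M => FreeIn (i + 1) M

/-- A closed term: no variable occurs free. -/
def Closed (M : LTerm) : Prop := ∀ i, ¬ FreeIn i M

/-- A term of the form `(λx U) V`. -/
def IsBetaRedex (M : LTerm) : Prop := ∃ U V, M = app (lam U) V

/-- A term of the form `λx (U x)` where `x` is not free in `U`. -/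
def IsEtaRedex (M : LTerm) : Prop := ∃ U, M = lam (app U (var 0)) ∧ ¬ FreeIn 0 U

/-- The term contains neither a `β`-redex nor an `η`-redex. -/
def BetaEtaNormal : LTerm → Prop
  | var _ => True
  | app M N => ¬ IsBetaRedex (app M N) ∧ BetaEtaNormal M ∧ BetaEtaNormal N
  | lam M => ¬ IsEtaRedex (lam M) ∧ BetaEtaNormal M

/-- `β`-equivalence: the least congruence that contains `β`-contraction. -/
inductive BetaEq : LTerm → LTerm → Prop
  | beta (M N : LTerm) : BetaEq (app (lam M) N) (inst M N)
  | app {M M' N N' : LTerm} : BetaEq M M' → BetaEq N N' → BetaEq (app M N) (app M' N')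
  | lam {M M' : LTerm} : BetaEq M M' → BetaEq (lam M) (lam M')
  | refl (M : LTerm) : BetaEq M M
  | symm {M N : LTerm} : BetaEq M N → BetaEq N M
  | trans {M N P : LTerm} : BetaEq M N → BetaEq N P → BetaEq M P

/-- `appList F [A₁, …, Aₚ]` is the iterated application `F A₁ ⋯ Aₚ`, associated to the left. -/
def appList (F : LTerm) (args : List LTerm) : LTerm := args.foldl LTerm.app F

end LTerm

/-- A numeral system: an infinite sequence of pairwise different closed `βη`-normal `λ`-terms. -/
structure IsNumeralSystem (d : ℕ → LTerm) : Prop where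
  injective : Function.Injective d
  closed : ∀ n, (d n).Closed
  normal : ∀ n, (d n).BetaEtaNormal

/-- The total function `φ : ℕᵖ → ℕ` is `λ`-definable with respect to `d`. -/
def LambdaDefinable (d : ℕ → LTerm) {p : ℕ} (φ : (Fin p → ℕ) → ℕ) : Prop :=
  ∃ F : LTerm, ∀ n : Fin p → ℕ,
    LTerm.BetaEq (F.appList (List.ofFn fun i => d (n i))) (d (φ n))

/-! Three facts about `k` suffice: `k n 0 = n + 1` yields a successor, `k (n + 1) 1 = n` a
predecessor, and the diagonal `k n n` is `1` at `n = 0` and `0` elsewhere. If `K` defines `k`, the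
term `λx. K x x` thus collapses all numerals onto `d 1` and `d 0`. These are different closed
βη-normal terms, so Böhm's theorem (`separable_of_ne`) gives closed arguments sending `d 1` to true
and `d 0` to false, which turns the diagonal into a zero test. With successor, predecessor and zero
test, every partial recursive function is representable (`exists_represents_partrec`): fixed points
solve the equations of primitive recursion and minimisation. The other direction only needs that `k`
is itself computable. Böhm's theorem is proved by replacing variables with tuplers of pairwise
different sizes, at least the total weight of the two terms. A head variable then never gets all the
arguments its tupler waits for, and further arguments can detect which head it is, how many
arguments it has, and what each argument is (`separable_subst_tupler`). -/

namespace LTerm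

/-! ### Substitution and β-equivalence -/

@[simp] theorem liftRen_zero (ξ : ℕ → ℕ) : liftRen ξ 0 = 0 := rfl
@[simp] theorem liftRen_succ (ξ : ℕ → ℕ) (i : ℕ) : liftRen ξ (i + 1) = ξ i + 1 := rfl
@[simp] theorem liftSubst_zero (σ : ℕ → LTerm) : liftSubst σ 0 = var 0 := rfl
@[simp] theorem liftSubst_succ (σ : ℕ → LTerm) (i : ℕ) :
    liftSubst σ (i + 1) = rename Nat.succ (σ i) := rfl
@[simp] theorem instSubst_zero (N : LTerm) : instSubst N 0 = N := rfl
@[simp] theorem instSubst_succ (N : LTerm) (i : ℕ) : instSubst N (i + 1) = var i := rfl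

theorem subst_congr {σ τ : ℕ → LTerm} {M : LTerm} (h : ∀ i, FreeIn i M → σ i = τ i) :
    subst σ M = subst τ M := by
  induction M generalizing σ τ with
  | var j => exact h j rfl
  | app M N ihM ihN =>
    simp only [subst]
    rw [ihM fun i hi => h i (Or.inl hi), ihN fun i hi => h i (Or.inr hi)]
  | lam M ih =>
    simp only [subst]
    rw [ih]
    rintro (_ | i) hi
    · rfl
    · simp [h i hi]

theorem liftSubst_var : liftSubst var = var := by
  funext i; cases i <;> rfl

theorem subst_var (M : LTerm) : subst var M = M := by
  induction M with
  | var j => rfl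
  | app M N ihM ihN => simp only [subst, ihM, ihN]
  | lam M ih => simp only [subst, liftSubst_var, ih]

theorem rename_eq_subst (ξ : ℕ → ℕ) (M : LTerm) : rename ξ M = subst (fun i => var (ξ i)) M := by
  induction M generalizing ξ with
  | var j => rfl
  | app M N ihM ihN => simp only [subst, rename, ihM, ihN]
  | lam M ih =>
    simp only [subst, rename, ih]
    congr 2
    funext i; cases i <;> rfl

theorem subst_rename (σ : ℕ → LTerm) (ξ : ℕ → ℕ) (M : LTerm) :
    subst σ (rename ξ M) = subst (fun i => σ (ξ i)) M := by
  induction M generalizing σ ξ with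
  | var j => rfl
  | app M N ihM ihN => simp only [subst, rename, ihM, ihN]
  | lam M ih =>
    simp only [subst, rename, ih]
    congr 2
    funext i; cases i <;> rfl

theorem rename_rename (ζ ξ : ℕ → ℕ) (M : LTerm) :
    rename ζ (rename ξ M) = rename (fun i => ζ (ξ i)) M := by
  rw [rename_eq_subst, subst_rename, rename_eq_subst]

theorem rename_subst (ξ : ℕ → ℕ) (σ : ℕ → LTerm) (M : LTerm) :
    rename ξ (subst σ M) = subst (fun i => rename ξ (σ i)) M := by
  induction M generalizing σ ξ with
  | var j => rfl
  | app M N ihM ihN => simp only [subst, rename, ihM, ihN]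
  | lam M ih =>
    simp only [subst, rename, ih]
    congr 2
    funext i
    cases i with
    | zero => rfl
    | succ i => simp [rename_rename]

theorem subst_subst (τ σ : ℕ → LTerm) (M : LTerm) :
    subst τ (subst σ M) = subst (fun i => subst τ (σ i)) M := by
  induction M generalizing σ τ with
  | var j => rfl
  | app M N ihM ihN => simp only [subst, ihM, ihN]
  | lam M ih =>
    simp only [subst, ih]
    congr 2
    funext i
    cases i with
    | zero => rfl
    | succ i => simp [rename_subst, subst_rename]

theorem subst_instSubst_rename (N M : LTerm) : subst (instSubst N) (rename Nat.succ M) = M := by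
  rw [subst_rename]; exact subst_var M

theorem subst_inst (σ : ℕ → LTerm) (M N : LTerm) :
    subst σ (inst M N) = inst (subst (liftSubst σ) M) (subst σ N) := by
  simp only [inst, subst_subst]
  congr 1
  funext i
  cases i with
  | zero => rfl
  | succ i => simp [subst, subst_instSubst_rename]

/-- Used to close a defining term that has free variables: numerals are closed, so a substitution
leaves them alone. -/
theorem BetaEq.subst {M N : LTerm} (h : BetaEq M N) (σ : ℕ → LTerm) :
    BetaEq (M.subst σ) (N.subst σ) := by
  induction h generalizing σ with
  | beta M N => rw [subst_inst]; exact .beta _ _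
  | app _ _ ihM ihN => exact .app (ihM σ) (ihN σ)
  | lam _ ih => exact .lam (ih _)
  | refl M => exact .refl _
  | symm _ ih => exact (ih σ).symm
  | trans _ _ ih₁ ih₂ => exact (ih₁ σ).trans (ih₂ σ)

/-- Contraction of a head redex, with the contractum written in any form. -/
theorem BetaEq.of_subst {M N P : LTerm} (h : M.subst (instSubst N) = P) :
    BetaEq (.app (.lam M) N) P := h ▸ .beta M N

theorem BetaEq.of_eq {M N : LTerm} (h : M = N) : BetaEq M N := h ▸ .refl M

theorem BetaEq.app_left {M M' : LTerm} (h : BetaEq M M') (N : LTerm) :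
    BetaEq (.app M N) (.app M' N) := .app h (.refl N)

theorem BetaEq.app_right (M : LTerm) {N N' : LTerm} (h : BetaEq N N') :
    BetaEq (.app M N) (.app M N') := .app (.refl M) h

theorem Closed.subst {M : LTerm} (h : M.Closed) (σ : ℕ → LTerm) : M.subst σ = M := by
  rw [subst_congr (τ := var) fun i hi => (h i hi).elim, subst_var]

theorem Closed.rename {M : LTerm} (h : M.Closed) (ξ : ℕ → ℕ) : M.rename ξ = M := by
  rw [rename_eq_subst, h.subst]

theorem freeIn_rename {ξ : ℕ → ℕ} {M : LTerm} {j : ℕ} :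
    FreeIn j (rename ξ M) ↔ ∃ i, FreeIn i M ∧ ξ i = j := by
  induction M generalizing ξ j with
  | var i => simp [rename, FreeIn]
  | app M N ihM ihN => simp only [rename, FreeIn, ihM, ihN, or_and_right, exists_or]
  | lam M ih =>
    simp only [rename, FreeIn, ih]
    constructor
    · rintro ⟨_ | i, hi, h⟩
      · simp at h
      · exact ⟨i, hi, by simpa using h⟩
    · rintro ⟨i, hi, h⟩
      exact ⟨i + 1, hi, by simpa using h⟩

theorem freeIn_subst {σ : ℕ → LTerm} {M : LTerm} {j : ℕ} (h : FreeIn j (subst σ M)) :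
    ∃ i, FreeIn i M ∧ FreeIn j (σ i) := by
  induction M generalizing σ j with
  | var i => exact ⟨i, rfl, h⟩
  | app M N ihM ihN =>
    rcases h with h | h
    · obtain ⟨i, hi, hj⟩ := ihM h
      exact ⟨i, Or.inl hi, hj⟩
    · obtain ⟨i, hi, hj⟩ := ihN h
      exact ⟨i, Or.inr hi, hj⟩
  | lam M ih =>
    obtain ⟨_ | i, hi, hj⟩ := ih h
    · simp [FreeIn] at hj
    · obtain ⟨j', hj', e⟩ := freeIn_rename.1 hj
      obtain rfl : j' = j := by simpa using e
      exact ⟨i, hi, hj'⟩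

theorem closed_subst {σ : ℕ → LTerm} (h : ∀ i, (σ i).Closed) (M : LTerm) : (subst σ M).Closed :=
  fun j hj => by
    obtain ⟨i, -, hi⟩ := freeIn_subst hj
    exact h i j hi

theorem Closed.app {M N : LTerm} (hM : M.Closed) (hN : N.Closed) : (LTerm.app M N).Closed :=
  fun i hi => hi.elim (hM i) (hN i)

@[simp] theorem appList_nil (F : LTerm) : appList F [] = F := rfl

@[simp] theorem appList_cons (F A : LTerm) (l : List LTerm) :
    appList F (A :: l) = appList (app F A) l := rfl

@[simp] theorem appList_append (F : LTerm) (l l' : List LTerm) :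
    appList F (l ++ l') = appList (appList F l) l' := by
  simp [appList]

theorem subst_appList (σ : ℕ → LTerm) (F : LTerm) (l : List LTerm) :
    subst σ (appList F l) = appList (subst σ F) (l.map (subst σ)) := by
  induction l generalizing F with
  | nil => rfl
  | cons A l ih => simp [ih, subst]

theorem BetaEq.appList {M N : LTerm} (h : BetaEq M N) (l : List LTerm) :
    BetaEq (M.appList l) (N.appList l) := by
  induction l generalizing M N with
  | nil => exact h
  | cons A l ih => exact ih (h.app_left A)

theorem freeIn_appList {F : LTerm} {l : List LTerm} (hl : ∀ A ∈ l, A.Closed) {i : ℕ}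
    (h : FreeIn i (F.appList l)) : FreeIn i F := by
  induction l generalizing F with
  | nil => exact h
  | cons A l ih =>
    rw [List.forall_mem_cons] at hl
    exact (ih hl.2 h).resolve_right (hl.1 i)

/-! ### Constant functions, selectors and tuplers -/

/-- The identity combinator. -/
def combI : LTerm := lam (var 0)

theorem closed_combI : combI.Closed := by simp [combI, Closed, FreeIn]

theorem combI_app (M : LTerm) : BetaEq (app combI M) M := .of_subst rfl

theorem closed_lam {M : LTerm} (h : M.Closed) : (lam M).Closed := fun i => h (i + 1)

theorem closed_lam_app {M : LTerm} (hM : M.Closed) (A : LTerm) : BetaEq (app (lam M) A) M :=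
  .of_subst (hM.subst _)

/-- `λx₁ ⋯ λxₙ X`, for closed `X`. -/
def constFun (X : LTerm) : ℕ → LTerm
  | 0 => X
  | n + 1 => lam (constFun X n)

theorem closed_constFun {X : LTerm} (hX : X.Closed) (n : ℕ) : (constFun X n).Closed := by
  induction n with
  | zero => exact hX
  | succ n ih => exact closed_lam ih

theorem constFun_appList {X : LTerm} (hX : X.Closed) {n : ℕ} {l : List LTerm}
    (hl : l.length = n) : BetaEq ((constFun X n).appList l) X := by
  subst hl
  induction l with
  | nil => exact .refl X
  | cons A l ih => exact ((closed_lam_app (closed_constFun hX _) A).appList l).trans ih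

/-- `keepFirst n` applied to `A, A₁, …, Aₙ` gives `A`. -/
def keepFirst : ℕ → LTerm
  | 0 => combI
  | n + 1 => lam (lam (app (keepFirst n) (var 1)))

theorem closed_keepFirst (n : ℕ) : (keepFirst n).Closed := by
  induction n with
  | zero => exact closed_combI
  | succ n ih =>
    have h (i : ℕ) : ¬ FreeIn i (keepFirst n) := ih i
    simp [keepFirst, Closed, FreeIn, h]

theorem keepFirst_appList {A : LTerm} (hA : A.Closed) {n : ℕ} {l : List LTerm}
    (hl : l.length = n) : BetaEq ((app (keepFirst n) A).appList l) A := by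
  subst hl
  induction l with
  | nil => exact combI_app A
  | cons B l ih =>
    refine BetaEq.trans (BetaEq.appList ?_ l) ih
    refine BetaEq.trans (BetaEq.app_left (BetaEq.of_subst rfl) B) (BetaEq.of_subst ?_)
    simp [subst, (closed_keepFirst _).subst, hA.rename, hA.subst]

/-- `selector n i` applied to `n` arguments gives the argument with index `i`. -/
def selector : ℕ → ℕ → LTerm
  | n, 0 => keepFirst (n - 1)
  | n, i + 1 => lam (selector (n - 1) i)

theorem closed_selector (n i : ℕ) : (selector n i).Closed := by
  induction i generalizing n with
  | zero => exact closed_keepFirst _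
  | succ i ih => exact closed_lam (ih _)

theorem selector_appList {n : ℕ} {l : List LTerm} (hn : l.length = n) (hl : ∀ A ∈ l, A.Closed)
    {i : ℕ} (hi : i < l.length) : BetaEq ((selector n i).appList l) l[i] := by
  subst hn
  induction l generalizing i with
  | nil => simp at hi
  | cons A l ih =>
    rw [List.forall_mem_cons] at hl
    cases i with
    | zero => exact keepFirst_appList hl.1 (by simp)
    | succ i =>
      exact ((closed_lam_app (closed_selector _ i) A).appList l).trans
        (ih hl.2 (by simpa using hi))

/-- `tuplerAux n` applied to `f, A₁, …, Aₙ, B` gives `f B A₁ ⋯ Aₙ`. -/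
def tuplerAux : ℕ → LTerm
  | 0 => combI
  | n + 1 => lam (lam (app (tuplerAux n) (lam (app (app (var 2) (var 0)) (var 1)))))

theorem closed_tuplerAux (n : ℕ) : (tuplerAux n).Closed := by
  induction n with
  | zero => exact closed_combI
  | succ n ih =>
    have h (i : ℕ) : ¬ FreeIn i (tuplerAux n) := ih i
    simp [tuplerAux, Closed, FreeIn, h]

/-- `f` is an accumulator: on receiving `A` it becomes `λz. f z A`, so the term `B` that arrives
last ends up in front of the stored arguments. -/
theorem tuplerAux_appList {n : ℕ} {l : List LTerm} (hn : l.length = n) (hl : ∀ A ∈ l, A.Closed)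
    {f : LTerm} (hf : f.Closed) (B : LTerm) :
    BetaEq (app ((app (tuplerAux n) f).appList l) B) ((app f B).appList l) := by
  subst hn
  induction l generalizing f with
  | nil => exact (combI_app f).app_left B
  | cons A l ih =>
    rw [List.forall_mem_cons] at hl
    have hA (i : ℕ) : ¬ FreeIn i A := hl.1 i
    have hf' (i : ℕ) : ¬ FreeIn i f := hf i
    have h₁ : BetaEq (app (app (tuplerAux (l.length + 1)) f) A)
        (app (tuplerAux l.length) (lam (app (app f (var 0)) A))) := by
      refine BetaEq.trans (BetaEq.app_left (BetaEq.of_subst rfl) A) (BetaEq.of_subst ?_)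
      simp [subst, (closed_tuplerAux _).subst, hl.1.rename, hf.rename, hf.subst, rename]
    refine ((h₁.appList l).app_left B).trans ((ih hl.2 ?_).trans (BetaEq.appList ?_ l))
    · simp [Closed, FreeIn, hA, hf']
    · refine BetaEq.of_subst ?_
      simp [subst, hl.1.subst, hf.subst]

/-- `tupler n` applied to `A₁, …, Aₙ, B` gives `B A₁ ⋯ Aₙ`. -/
def tupler (n : ℕ) : LTerm := app (tuplerAux n) combI

theorem closed_tupler (n : ℕ) : (tupler n).Closed := (closed_tuplerAux n).app closed_combI

theorem tupler_appList {n : ℕ} {l : List LTerm} (hn : l.length = n) (hl : ∀ A ∈ l, A.Closed)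
    (B : LTerm) : BetaEq (app ((tupler n).appList l) B) (B.appList l) :=
  (tuplerAux_appList hn hl closed_combI B).trans ((combI_app B).appList l)

/-! ### Separating partially filled tuplers -/

/-- Two terms are separable if some closed arguments send them to any two given closed terms. -/
def Separable (M N : LTerm) : Prop :=
  ∀ X Y : LTerm, X.Closed → Y.Closed → ∃ l : List LTerm, (∀ A ∈ l, A.Closed) ∧
    BetaEq (M.appList l) X ∧ BetaEq (N.appList l) Y

theorem Separable.symm {M N : LTerm} (h : Separable M N) : Separable N M := fun X Y hX hY =>
  let ⟨l, hl, h₁, h₂⟩ := h Y X hY hX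
  ⟨l, hl, h₂, h₁⟩

theorem Separable.of_appList {M N M' N' : LTerm} (h : Separable M' N') {l : List LTerm}
    (hl : ∀ A ∈ l, A.Closed) (hM : BetaEq (M.appList l) M') (hN : BetaEq (N.appList l) N') :
    Separable M N := fun X Y hX hY => by
  obtain ⟨l', hl', h₁, h₂⟩ := h X Y hX hY
  refine ⟨l ++ l', fun A hA => (List.mem_append.1 hA).elim (hl A) (hl' A), ?_, ?_⟩
  · rw [appList_append]; exact (hM.appList l').trans h₁
  · rw [appList_append]; exact (hN.appList l').trans h₂

theorem mem_replicate_closed {n : ℕ} : ∀ A ∈ List.replicate n combI, A.Closed := fun A hA => by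
  rw [List.eq_of_mem_replicate hA]; exact closed_combI

/-- After the common filling `R`, the first tupler is full and hands control to `B`, a constant
function with value `X`. The second, which misses more, merely stores `B`, fills up with `E`, and
hands control to `C`, constant with value `Y`. -/
theorem separable_of_missing_lt {n n' : ℕ} {l l' : List LTerm} (hl : ∀ A ∈ l, A.Closed)
    (hl' : ∀ A ∈ l', A.Closed) (hn : l.length ≤ n)
    (h : n - l.length < n' - l'.length) :
    Separable ((tupler n).appList l) ((tupler n').appList l') := by
  intro X Y hX hY
  obtain ⟨e, he⟩ : ∃ e, n' - l'.length = n - l.length + 1 + e := ⟨_, (Nat.add_sub_of_le h).symm⟩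
  set R := List.replicate (n - l.length) combI
  set E := List.replicate e combI
  have hR : R.length = n - l.length := List.length_replicate
  have hE : E.length = e := List.length_replicate
  have hRc : ∀ A ∈ R, A.Closed := mem_replicate_closed
  have hEc : ∀ A ∈ E, A.Closed := mem_replicate_closed
  set B := constFun X (n + e + 1)
  set C := constFun Y n'
  have hB : B.Closed := closed_constFun hX _
  have hC : C.Closed := closed_constFun hY _
  refine ⟨R ++ [B] ++ E ++ [C], ?_, ?_, ?_⟩
  · simp only [List.mem_append, List.mem_singleton]
    rintro A (((h | rfl) | h) | rfl)
    exacts [hRc A h, hB, hEc A h, hC]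
  · have h₁ := tupler_appList (n := n) (l := l ++ R) (by simp [hR]; omega)
      (fun A hA => (List.mem_append.1 hA).elim (hl A) (hRc A)) B
    have h₂ := (h₁.appList E).app_left C
    have h₃ := constFun_appList hX (n := n + e + 1) (l := l ++ R ++ E ++ [C])
      (by simp [hR, hE]; omega)
    simp only [appList_append, appList_cons, appList_nil] at h₁ h₂ h₃ ⊢
    exact h₂.trans h₃
  · have h₁ := tupler_appList (n := n') (l := l' ++ R ++ [B] ++ E) (by simp [hR, hE]; omega)
      (by
        simp only [List.mem_append, List.mem_singleton]
        rintro A (((h | h) | rfl) | h)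
        exacts [hl' A h, hRc A h, hB, hEc A h]) C
    have h₃ := constFun_appList hY (n := n') (l := l' ++ R ++ [B] ++ E)
      (by simp [hR, hE]; omega)
    simp only [appList_append, appList_cons, appList_nil] at h₁ h₃ ⊢
    exact h₁.trans h₃

/-- Both tuplers become full at `r` and call `B`, which discards `n + e` arguments and returns the
identity. On the left these include `r` and all of `E`, so `X` remains. On the right, `n' = n + e +
1` entries are stored, so `r` is the first to survive; it discards `E` and `X` and returns `Y`. -/
theorem separable_of_lt {n n' : ℕ} {l l' : List LTerm} (hl : ∀ A ∈ l, A.Closed)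
    (hl' : ∀ A ∈ l', A.Closed) (hn : l.length < n) (hlt : n < n')
    (h : n - l.length = n' - l'.length) :
    Separable ((tupler n).appList l) ((tupler n').appList l') := by
  intro X Y hX hY
  obtain ⟨m, hm⟩ : ∃ m, n - l.length = m + 1 := ⟨n - l.length - 1, by omega⟩
  obtain ⟨e, he⟩ : ∃ e, n' = n + e + 1 := ⟨n' - n - 1, by omega⟩
  set R := List.replicate m combI
  set E := List.replicate e combI
  have hR : R.length = m := List.length_replicate
  have hE : E.length = e := List.length_replicate
  have hRc : ∀ A ∈ R, A.Closed := mem_replicate_closed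
  have hEc : ∀ A ∈ E, A.Closed := mem_replicate_closed
  set r := constFun Y (e + 1)
  set B := constFun combI (n + e)
  have hr : r.Closed := closed_constFun hY _
  have hB : B.Closed := closed_constFun closed_combI _
  have hR' {k : List LTerm} (hk : ∀ A ∈ k, A.Closed) : ∀ A ∈ k ++ R ++ [r], A.Closed := by
    simp only [List.mem_append, List.mem_singleton]
    rintro A ((h | h) | rfl)
    exacts [hk A h, hRc A h, hr]
  refine ⟨R ++ [r] ++ [B] ++ E ++ [X], ?_, ?_, ?_⟩
  · simp only [List.mem_append, List.mem_singleton]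
    rintro A ((((h | rfl) | rfl) | h) | rfl)
    exacts [hRc A h, hr, hB, hEc A h, hX]
  · have h₁ := tupler_appList (n := n) (l := l ++ R ++ [r]) (by simp [hR]; omega) (hR' hl) B
    have h₂ := (h₁.appList E).app_left X
    have h₃ := (constFun_appList closed_combI (n := n + e) (l := l ++ R ++ [r] ++ E)
      (by simp [hR, hE]; omega)).app_left X
    simp only [appList_append, appList_cons, appList_nil] at h₁ h₂ h₃ ⊢
    exact h₂.trans (h₃.trans (combI_app X))
  · have h₁ := tupler_appList (n := n') (l := l' ++ R ++ [r]) (by simp [hR]; omega) (hR' hl') B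
    have h₂ := (h₁.appList E).app_left X
    have h₃ := (((constFun_appList closed_combI (n := n + e) (l := l' ++ R)
      (by simp [hR]; omega)).app_left r).trans (combI_app r)).appList (E ++ [X])
    have h₄ := constFun_appList hY (n := e + 1) (l := E ++ [X]) (by simp [hE])
    simp only [appList_append, appList_cons, appList_nil] at h₁ h₂ h₃ h₄ ⊢
    exact h₂.trans (h₃.trans h₄)

/-- Identities fill the tupler, and a selector then extracts the entry with index `i`. -/
theorem Separable.of_getElem {n i : ℕ} {l l' : List LTerm} (hl : ∀ A ∈ l, A.Closed)
    (hl' : ∀ A ∈ l', A.Closed) (hn : l.length ≤ n) (hll' : l'.length = l.length)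
    (hi : i < l.length) (h : Separable l[i] l'[i]) :
    Separable ((tupler n).appList l) ((tupler n).appList l') := by
  set R := List.replicate (n - l.length) combI
  have hR : R.length = n - l.length := List.length_replicate
  have hRc : ∀ A ∈ R, A.Closed := mem_replicate_closed
  have key {k : List LTerm} (hk : ∀ A ∈ k, A.Closed) (hkl : k.length = l.length) :
      BetaEq (((tupler n).appList k).appList (R ++ [selector n i])) (k[i]'(hkl ▸ hi)) := by
    have hkR : ∀ A ∈ k ++ R, A.Closed := fun A hA =>
      (List.mem_append.1 hA).elim (hk A) (hRc A)
    have hlen : (k ++ R).length = n := by simp [hR, hkl]; omega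
    have h₁ := tupler_appList hlen hkR (selector n i)
    have h₂ := selector_appList hlen hkR (i := i) (by simp [hkl]; omega)
    rw [List.getElem_append_left (hkl ▸ hi)] at h₂
    have h₃ := h₁.trans h₂
    simp only [appList_append, appList_cons, appList_nil] at h₃ ⊢
    exact h₃
  refine h.of_appList (l := R ++ [selector n i]) ?_ (key hl rfl) (key hl' hll')
  intro A hA
  rcases List.mem_append.1 hA with h | h
  · exact hRc A h
  · rw [List.mem_singleton.1 h]; exact closed_selector n i

/-! ### Böhm's theorem -/

/-- The size of a term, with a double weight on abstractions. -/
def weight : LTerm → ℕ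
  | var _ => 1
  | app M N => weight M + weight N
  | lam M => weight M + 2

theorem weight_pos (M : LTerm) : 0 < weight M := by
  induction M with
  | var => exact Nat.one_pos
  | app M N ihM _ => exact Nat.add_pos_left ihM _
  | lam M _ => exact Nat.succ_pos _

theorem weight_rename (ξ : ℕ → ℕ) (M : LTerm) : weight (rename ξ M) = weight M := by
  induction M generalizing ξ with
  | var => rfl
  | app M N ihM ihN => simp only [rename, weight, ihM, ihN]
  | lam M ih => simp only [rename, weight, ih]

theorem weight_appList (F : LTerm) (l : List LTerm) :
    weight (F.appList l) = weight F + (l.map weight).sum := by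
  induction l generalizing F with
  | nil => rfl
  | cons A l ih => simp [ih, weight, Nat.add_assoc]

theorem length_le_sum_weight (l : List LTerm) : l.length ≤ (l.map weight).sum := by
  induction l with
  | nil => rfl
  | cons A l ih =>
    have := weight_pos A
    simp only [List.map_cons, List.sum_cons, List.length_cons]
    omega

theorem weight_le_sum {l : List LTerm} {A : LTerm} (h : A ∈ l) :
    weight A ≤ (l.map weight).sum := List.le_sum_of_mem (List.mem_map_of_mem h)

theorem BetaEtaNormal.rename {M : LTerm} (h : M.BetaEtaNormal) (ξ : ℕ → ℕ) :
    (M.rename ξ).BetaEtaNormal := by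
  induction M generalizing ξ with
  | var => trivial
  | app M N ihM ihN =>
    refine ⟨?_, ihM h.2.1 ξ, ihN h.2.2 ξ⟩
    rintro ⟨U, V, e⟩
    refine h.1 ?_
    cases M with
    | var => simp [LTerm.rename] at e
    | app => simp [LTerm.rename] at e
    | lam M => exact ⟨_, _, rfl⟩
  | lam M ih =>
    refine ⟨?_, ih h.2 _⟩
    rintro ⟨U, e, hU⟩
    refine h.1 ?_
    cases M with
    | var => simp [LTerm.rename] at e
    | lam => simp [LTerm.rename] at e
    | app M N =>
      cases N with
      | app => simp [LTerm.rename] at e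
      | lam => simp [LTerm.rename] at e
      | var i =>
        cases i with
        | succ i => simp [LTerm.rename] at e
        | zero =>
          simp only [LTerm.rename, lam.injEq, app.injEq] at e
          refine ⟨M, rfl, fun h0 => hU ?_⟩
          rw [← e.1]
          exact freeIn_rename.2 ⟨0, h0, rfl⟩

theorem BetaEtaNormal.eq_lam_or_eq_appList {M : LTerm} (h : M.BetaEtaNormal) :
    (∃ U, M = lam U) ∨
      ∃ x l, M = (var x).appList l ∧ ∀ A ∈ l, A.BetaEtaNormal := by
  induction M with
  | var x => exact Or.inr ⟨x, [], rfl, by simp⟩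
  | lam U => exact Or.inl ⟨U, rfl⟩
  | app M N ihM _ =>
    rcases ihM h.2.1 with ⟨U, rfl⟩ | ⟨x, l, rfl, hl⟩
    · exact (h.1 ⟨U, N, rfl⟩).elim
    · refine Or.inr ⟨x, l ++ [N], by simp, fun A hA => ?_⟩
      rcases List.mem_append.1 hA with hA | hA
      · exact hl A hA
      · rw [List.mem_singleton.1 hA]; exact h.2.2

theorem not_isBetaRedex_appList (x : ℕ) (l : List LTerm) (N : LTerm) :
    ¬ IsBetaRedex (app ((var x).appList l) N) := by
  rintro ⟨U, V, e⟩
  rcases List.eq_nil_or_concat l with rfl | ⟨l, A, rfl⟩ <;> simp at e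

/-- The assignment that gives `a` to the index `0` and shifts the others. -/
def consAssign (a : ℕ) (ν : ℕ → ℕ) : ℕ → ℕ
  | 0 => a
  | i + 1 => ν i

theorem lam_subst_tupler_app (a : ℕ) (ν : ℕ → ℕ) (U : LTerm) :
    BetaEq (app ((lam U).subst fun i => tupler (ν i)) (tupler a))
      (U.subst fun i => tupler (consAssign a ν i)) := by
  refine BetaEq.of_subst ?_
  rw [subst_subst]
  congr 1
  funext i
  cases i with
  | zero => rfl
  | succ i => exact subst_instSubst_rename _ _

/-- **Böhm's theorem** for open terms, the variables being replaced by tuplers of pairwise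
different large sizes. -/
theorem separable_subst_tupler (b : ℕ) :
    ∀ (w : ℕ) (M N : LTerm) (ν : ℕ → ℕ), weight M + weight N ≤ w → w ≤ b →
      Function.Injective ν → (∀ i, b ≤ ν i) → (∀ m, ∃ a, m ≤ a ∧ a ∉ Set.range ν) →
      M.BetaEtaNormal → N.BetaEtaNormal → M ≠ N →
      Separable (M.subst fun i => tupler (ν i)) (N.subst fun i => tupler (ν i)) := by
  intro w
  induction w using Nat.strong_induction_on with
  | _ w ih =>
  intro M N ν hw hb hν hbν hfresh hM hN hMN
  -- The size `a` is for the variable released by opening a binder: large, and different from all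
  -- sizes in use.
  obtain ⟨a, hba, ha⟩ := hfresh b
  have hν' : Function.Injective (consAssign a ν) := by
    rintro (_ | i) (_ | j) hij
    · rfl
    · exact (ha ⟨j, hij.symm⟩).elim
    · exact (ha ⟨i, hij⟩).elim
    · rw [hν hij]
  have hbν' : ∀ i, b ≤ consAssign a ν i := by
    rintro (_ | i)
    exacts [hba, hbν i]
  have hfresh' : ∀ m, ∃ c, m ≤ c ∧ c ∉ Set.range (consAssign a ν) := fun m => by
    obtain ⟨c, hc, hcν⟩ := hfresh (max m (a + 1))
    refine ⟨c, le_of_max_le_left hc, ?_⟩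
    rintro ⟨_ | i, hi⟩
    · have : a + 1 ≤ c := le_of_max_le_right hc
      simp only [consAssign] at hi
      omega
    · exact hcν ⟨i, hi⟩
  have hcl : ∀ A ∈ [tupler a], A.Closed := by simpa using closed_tupler a
  -- an abstraction against a term with a head variable, which is `η`-expanded
  have mixed : ∀ (U : LTerm) (x : ℕ) (l : List LTerm), (lam U).BetaEtaNormal →
      ((var x).appList l).BetaEtaNormal → weight (lam U) + weight ((var x).appList l) ≤ w →
      Separable ((lam U).subst fun i => tupler (ν i))
        (((var x).appList l).subst fun i => tupler (ν i)) := by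
    intro U x l hU hl hle
    set T := (var x).appList l
    -- The double weight of abstractions pays off here: opening `lam U` gains two, while the new
    -- argument of `T` costs one.
    have hlt : weight U + weight (app (T.rename Nat.succ) (var 0)) < w := by
      simp only [weight, weight_rename] at hle ⊢
      omega
    refine (ih _ hlt U (app (T.rename Nat.succ) (var 0)) (consAssign a ν) le_rfl
      (hlt.le.trans hb) hν' hbν' hfresh' hU.2 ⟨?_, hl.rename _, trivial⟩ ?_).of_appList hcl
      (lam_subst_tupler_app a ν U) (.of_eq ?_)
    · rw [rename_eq_subst, subst_appList]
      exact not_isBetaRedex_appList _ _ _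
    -- If `U` were the expansion of `T`, then `lam U` would be an η-redex.
    · rintro rfl
      refine hU.1 ⟨_, rfl, fun h => ?_⟩
      obtain ⟨i, -, hi⟩ := freeIn_rename.1 h
      exact Nat.succ_ne_zero i hi
    · simp only [appList_cons, appList_nil, subst, subst_rename]
      rfl
  rcases hM.eq_lam_or_eq_appList with ⟨U, rfl⟩ | ⟨x, l, rfl, hl⟩ <;>
    rcases hN.eq_lam_or_eq_appList with ⟨V, rfl⟩ | ⟨y, l', rfl, hl'⟩
  · have hlt : weight U + weight V < w := by
      simp only [weight] at hw
      omega
    exact (ih _ hlt U V (consAssign a ν) le_rfl (hlt.le.trans hb) hν' hbν' hfresh' hM.2 hN.2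
      (fun h => hMN (h ▸ rfl))).of_appList hcl (lam_subst_tupler_app a ν U)
      (lam_subst_tupler_app a ν V)
  · exact mixed U y l' hM hN hw
  · exact (mixed V x l hN hM (by omega)).symm
  · set σ : ℕ → LTerm := fun i => tupler (ν i)
    have hσ : ∀ k : List LTerm, ∀ A ∈ k.map (subst σ), A.Closed := fun k A hA => by
      obtain ⟨B, -, rfl⟩ := List.mem_map.1 hA
      exact closed_subst (fun i => closed_tupler _) B
    rw [weight_appList, weight_appList] at hw
    have h₁ := length_le_sum_weight l
    have h₂ := length_le_sum_weight l'
    have hx := hbν x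
    have hy := hbν y
    simp only [weight] at hw
    simp only [subst_appList, subst, σ]
    -- The compared numbers count the missing arguments. The subtractions are not truncated, since
    -- the weights, hence the lengths of `l` and `l'`, are below `b`.
    rcases lt_trichotomy (ν x - l.length) (ν y - l'.length) with h | h | h
    · exact separable_of_missing_lt (hσ l) (hσ l') (by simp; omega) (by simpa using h)
    · by_cases hxy : x = y
      · subst hxy
        have hll' : l'.length = l.length := by omega
        -- Equal heads with equally many missing arguments have equally many arguments, so some pair
        -- of arguments differs.
        obtain ⟨i, hi, hne⟩ : ∃ (i : ℕ) (hi : i < l.length), l[i] ≠ l'[i] := by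
          by_contra hcon
          push Not at hcon
          exact hMN (by rw [List.ext_getElem hll'.symm fun i hi _ => hcon i hi])
        have hi' : i < l'.length := hll' ▸ hi
        refine Separable.of_getElem (i := i) (hσ l) (hσ l') (by simp; omega) (by simpa using hll')
          (by simpa using hi) ?_
        simp only [List.getElem_map]
        have w₁ := weight_le_sum (List.getElem_mem hi)
        have w₂ := weight_le_sum (List.getElem_mem hi')
        have hlt : weight l[i] + weight l'[i] < w := by omega
        exact ih _ hlt _ _ ν le_rfl (hlt.le.trans hb) hν hbν hfresh (hl _ (List.getElem_mem hi))
          (hl' _ (List.getElem_mem hi')) hne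
      · rcases lt_or_gt_of_ne (fun e => hxy (hν e)) with hlt | hlt
        · exact separable_of_lt (hσ l) (hσ l') (by simp; omega) hlt (by simpa using h)
        · exact (separable_of_lt (hσ l') (hσ l) (by simp; omega) hlt
            (by simpa using h.symm)).symm
    · exact (separable_of_missing_lt (hσ l') (hσ l) (by simp; omega) (by simpa using h)).symm

/-- **Böhm's theorem**: different closed `βη`-normal terms are separable. -/
theorem separable_of_ne {M N : LTerm} (hM : M.BetaEtaNormal) (hN : N.BetaEtaNormal)
    (hMc : M.Closed) (hNc : N.Closed) (hMN : M ≠ N) : Separable M N := by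
  -- Sizes at even offsets leave all odd offsets available as fresh sizes.
  have h := separable_subst_tupler (weight M + weight N) _ M N
    (fun i => weight M + weight N + 2 * i) le_rfl le_rfl (fun i j h => by simpa using h)
    (fun i => by omega) (fun m => ⟨weight M + weight N + 2 * m + 1, by omega, ?_⟩) hM hN hMN
  · rwa [hMc.subst, hNc.subst] at h
  · rintro ⟨i, hi⟩
    simp only at hi
    omega

/-! ### Fixed points, truth values, pairs and tuples -/

theorem exists_fixedPoint {M : LTerm} (hM : M.Closed) :
    ∃ R : LTerm, R.Closed ∧ BetaEq R (app M R) := by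
  have h (i : ℕ) : ¬ FreeIn i M := hM i
  have hW : (lam (app M (app (var 0) (var 0)))).Closed := by simp [Closed, FreeIn, h]
  refine ⟨_, hW.app hW, .of_subst ?_⟩
  simp [subst, hM.subst]

/-- The first projection of two arguments, used as truth value. -/
def combTrue : LTerm := lam (lam (var 1))

/-- The second projection of two arguments, used as truth value. -/
def combFalse : LTerm := lam (lam (var 0))

theorem closed_combTrue : combTrue.Closed := by simp [combTrue, Closed, FreeIn]

theorem closed_combFalse : combFalse.Closed := by simp [combFalse, Closed, FreeIn]

theorem combTrue_app {A : LTerm} (B : LTerm) (hA : A.Closed) :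
    BetaEq (app (app combTrue A) B) A :=
  (BetaEq.app_left (BetaEq.of_subst rfl) B).trans
    (BetaEq.of_subst (by simp [subst, hA.rename, hA.subst]))

theorem combFalse_app (A B : LTerm) : BetaEq (app (app combFalse A) B) B :=
  ((closed_lam_app closed_combI A).app_left B).trans (combI_app B)

/-- The pair `λz. z A B` of closed terms. -/
def mkPair (A B : LTerm) : LTerm := lam (app (app (var 0) A) B)

theorem closed_mkPair {A B : LTerm} (hA : A.Closed) (hB : B.Closed) : (mkPair A B).Closed := by
  have h (i : ℕ) : ¬ FreeIn i A := hA i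
  have h' (i : ℕ) : ¬ FreeIn i B := hB i
  simp [mkPair, Closed, FreeIn, h, h']

/-- The pairing combinator. -/
def combPair : LTerm := lam (lam (lam (app (app (var 0) (var 2)) (var 1))))

/-- The first projection of pairs. -/
def combFst : LTerm := lam (app (var 0) combTrue)

/-- The second projection of pairs. -/
def combSnd : LTerm := lam (app (var 0) combFalse)

theorem closed_combPair : combPair.Closed := by simp [combPair, Closed, FreeIn]

theorem closed_combFst : combFst.Closed := by simp [combFst, combTrue, Closed, FreeIn]

theorem closed_combSnd : combSnd.Closed := by simp [combSnd, combFalse, Closed, FreeIn]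

theorem combPair_app {A B : LTerm} (hA : A.Closed) (hB : B.Closed) :
    BetaEq (app (app combPair A) B) (mkPair A B) := by
  refine BetaEq.trans (BetaEq.app_left (BetaEq.of_subst rfl) B) (BetaEq.of_subst ?_)
  simp [subst, hA.rename, hA.subst, hB.rename, mkPair, rename]

theorem mkPair_app {A B C : LTerm} (hA : A.Closed) (hB : B.Closed) :
    BetaEq (app (mkPair A B) C) (app (app C A) B) :=
  .of_subst (by simp [subst, hA.subst, hB.subst])

theorem combFst_app {A B : LTerm} (hA : A.Closed) (hB : B.Closed) :
    BetaEq (app combFst (mkPair A B)) A := by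
  refine BetaEq.trans (.of_subst rfl) ((mkPair_app hA hB).trans ?_)
  simp only [closed_combTrue.subst]
  exact combTrue_app B hA

theorem combSnd_app {A B : LTerm} (hA : A.Closed) (hB : B.Closed) :
    BetaEq (app combSnd (mkPair A B)) B := by
  refine BetaEq.trans (.of_subst rfl) ((mkPair_app hA hB).trans ?_)
  simp only [closed_combFalse.subst]
  exact combFalse_app A B

/-- The composition of closed terms. -/
def comp (F G : LTerm) : LTerm := lam (app F (app G (var 0)))

theorem closed_comp {F G : LTerm} (hF : F.Closed) (hG : G.Closed) : (comp F G).Closed := by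
  have h (i : ℕ) : ¬ FreeIn i F := hF i
  have h' (i : ℕ) : ¬ FreeIn i G := hG i
  simp [comp, Closed, FreeIn, h, h']

theorem comp_app {F G : LTerm} (hF : F.Closed) (hG : G.Closed) (A : LTerm) :
    BetaEq (app (comp F G) A) (app F (app G A)) :=
  .of_subst (by simp [subst, hF.subst, hG.subst])

/-- The pointwise pairing of closed terms. -/
def pairing (F G : LTerm) : LTerm := lam (app (app combPair (app F (var 0))) (app G (var 0)))

theorem closed_pairing {F G : LTerm} (hF : F.Closed) (hG : G.Closed) : (pairing F G).Closed := by
  have h (i : ℕ) : ¬ FreeIn i F := hF i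
  have h' (i : ℕ) : ¬ FreeIn i G := hG i
  simp [pairing, combPair, Closed, FreeIn, h, h']

theorem pairing_app {F G A B C : LTerm} (hF : F.Closed) (hG : G.Closed) (hB : B.Closed)
    (hC : C.Closed) (hFA : BetaEq (app F A) B) (hGA : BetaEq (app G A) C) :
    BetaEq (app (pairing F G) A) (mkPair B C) := by
  refine BetaEq.trans (.of_subst (P := app (app combPair (app F A)) (app G A)) ?_)
    ((BetaEq.app (BetaEq.app_right combPair hFA) hGA).trans (combPair_app hB hC))
  simp [subst, hF.subst, hG.subst, closed_combPair.subst]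

/-- The encoding of a list of natural numbers by nested pairs of numerals. -/
def tuple (d : ℕ → LTerm) : List ℕ → LTerm
  | [] => combI
  | a :: l => mkPair (d a) (tuple d l)

theorem closed_tuple {d : ℕ → LTerm} (hd : ∀ n, (d n).Closed) (l : List ℕ) :
    (tuple d l).Closed := by
  induction l with
  | nil => exact closed_combI
  | cons a l ih => exact closed_mkPair (hd a) ih

/-- The curried form of a term that expects a tuple of length `p`. -/
def combCurry : ℕ → LTerm
  | 0 => lam (app (var 0) combI)
  | p + 1 => lam (lam (app (combCurry p)
      (lam (app (var 2) (app (app combPair (var 1)) (var 0))))))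

theorem closed_combCurry (p : ℕ) : (combCurry p).Closed := by
  induction p with
  | zero => simp [combCurry, combI, Closed, FreeIn]
  | succ p ih =>
    have h (i : ℕ) : ¬ FreeIn i (combCurry p) := ih i
    simp [combCurry, combPair, Closed, FreeIn, h]

/-- Each numeral is absorbed into the function: `F` becomes `G = λt. F (pair a t)`, which awaits a
shorter tuple. -/
theorem combCurry_appList {d : ℕ → LTerm} (hd : ∀ n, (d n).Closed) {F : LTerm} (hF : F.Closed)
    (l : List ℕ) :
    BetaEq ((app (combCurry l.length) F).appList (l.map d)) (app F (tuple d l)) := by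
  induction l generalizing F with
  | nil => exact .of_subst (by simp [subst, closed_combI.subst, tuple])
  | cons a l ih =>
    set G := lam (app F (app (app combPair (d a)) (var 0)))
    have hG : G.Closed := by
      have h (i : ℕ) : ¬ FreeIn i F := hF i
      have h' (i : ℕ) : ¬ FreeIn i (d a) := hd a i
      simp [G, combPair, Closed, FreeIn, h, h']
    have h₁ : BetaEq (app (app (combCurry (l.length + 1)) F) (d a))
        (app (combCurry l.length) G) := by
      refine BetaEq.trans (BetaEq.app_left (BetaEq.of_subst rfl) _) (BetaEq.of_subst ?_)
      simp [subst, (closed_combCurry _).subst, closed_combPair.subst, hF.rename, hF.subst,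
        (hd a).rename, rename, G]
    refine (h₁.appList _).trans ((ih hG).trans ?_)
    refine BetaEq.trans (BetaEq.of_subst (P := app F (app (app combPair (d a)) (tuple d l))) ?_)
      (BetaEq.app_right F (combPair_app (hd a) (closed_tuple hd l)))
    simp [subst, hF.subst, closed_combPair.subst, (hd a).subst]

end LTerm

open LTerm

/-! ### Representing the recursive functions -/

/-- A sequence of closed terms with closed terms for successor, predecessor and zero test. -/
structure AdequateSystem (d : ℕ → LTerm) (S P Z : LTerm) : Prop where
  closed : ∀ n, (d n).Closed
  closed_succ : S.Closed
  closed_pred : P.Closed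
  closed_isZero : Z.Closed
  succ_app : ∀ n, BetaEq (app S (d n)) (d (n + 1))
  pred_app : ∀ n, BetaEq (app P (d (n + 1))) (d n)
  isZero_zero : BetaEq (app Z (d 0)) combTrue
  isZero_succ : ∀ n, BetaEq (app Z (d (n + 1))) combFalse

/-- The closed term `F` represents the partial function `f` on tuples of numerals. -/
def Represents (d : ℕ → LTerm) (F : LTerm) {n : ℕ} (f : List.Vector ℕ n →. ℕ) : Prop :=
  F.Closed ∧ ∀ v, ∀ m ∈ f v, BetaEq (app F (tuple d v.toList)) (d m)

theorem exists_represents_mOfFn {d : ℕ → LTerm} (hd : ∀ n, (d n).Closed) {m n : ℕ}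
    (g : Fin n → List.Vector ℕ m →. ℕ) (hg : ∀ i, ∃ G, Represents d G (g i)) :
    ∃ G : LTerm, G.Closed ∧ ∀ v, ∀ w ∈ List.Vector.mOfFn fun i => g i v,
      BetaEq (app G (tuple d v.toList)) (tuple d w.toList) := by
  induction n with
  | zero =>
    refine ⟨lam combI, closed_lam closed_combI, fun v w hw => ?_⟩
    obtain rfl : w = List.Vector.nil := w.eq_nil
    exact closed_lam_app closed_combI _
  | succ n ih =>
    obtain ⟨F, hF, hF'⟩ := hg 0
    obtain ⟨G, hG, hG'⟩ := ih (fun i => g i.succ) fun i => hg i.succ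
    refine ⟨pairing F G, closed_pairing hF hG, fun v w hw => ?_⟩
    simp only [List.Vector.mOfFn, Part.bind_eq_bind, Part.mem_bind_iff, Part.pure_eq_some,
      Part.mem_some_iff] at hw
    obtain ⟨a, ha, t, ht, rfl⟩ := hw
    rw [List.Vector.toList_cons]
    exact pairing_app hF hG (hd a) (closed_tuple hd _) (hF' v a ha) (hG' v t ht)

theorem exists_represents_get {d : ℕ → LTerm} (hd : ∀ n, (d n).Closed) {n : ℕ} (i : Fin n) :
    ∃ F, Represents d F fun v : List.Vector ℕ n => Part.some (v.get i) := by
  induction n with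
  | zero => exact i.elim0
  | succ n ih =>
    cases i using Fin.cases with
    | zero =>
      refine ⟨combFst, closed_combFst, fun v m hm => ?_⟩
      obtain rfl := Part.mem_some_iff.1 hm
      rw [← List.Vector.cons_head_tail v]
      exact combFst_app (hd _) (closed_tuple hd _)
    | succ i =>
      obtain ⟨F, hF, hF'⟩ := ih i
      refine ⟨comp F combSnd, closed_comp hF closed_combSnd, fun v m hm => ?_⟩
      obtain rfl := Part.mem_some_iff.1 hm
      rw [← List.Vector.cons_head_tail v]
      refine (comp_app hF closed_combSnd _).trans ?_
      refine (BetaEq.app_right F (combSnd_app (hd _) (closed_tuple hd _))).trans ?_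
      exact hF' v.tail _ (by simp [List.Vector.get_tail_succ])

theorem Represents.comp {d : ℕ → LTerm} (hd : ∀ n, (d n).Closed) {m n : ℕ} {F : LTerm}
    {f : List.Vector ℕ n →. ℕ} (hF : Represents d F f) (g : Fin n → List.Vector ℕ m →. ℕ)
    (hg : ∀ i, ∃ G, Represents d G (g i)) :
    ∃ H, Represents d H fun v => (List.Vector.mOfFn fun i => g i v) >>= f := by
  obtain ⟨G, hG, hG'⟩ := exists_represents_mOfFn hd g hg
  refine ⟨LTerm.comp F G, closed_comp hF.1 hG, fun v a ha => ?_⟩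
  obtain ⟨w, hw, ha⟩ := Part.mem_bind_iff.1 ha
  exact (comp_app hF.1 hG _).trans ((BetaEq.app_right F (hG' v w hw)).trans (hF.2 w a ha))

namespace AdequateSystem

variable {d : ℕ → LTerm} {S P Z : LTerm}

theorem exists_represents_prec (h : AdequateSystem d S P Z) {n : ℕ} {F G : LTerm}
    {f : List.Vector ℕ n → ℕ} {g : List.Vector ℕ (n + 2) → ℕ}
    (hF : Represents d F fun v => Part.some (f v)) (hG : Represents d G fun v => Part.some (g v)) :
    ∃ R, Represents d R fun v : List.Vector ℕ (n + 1) =>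
      Part.some (v.head.rec (f v.tail) fun y IH => g (y ::ᵥ IH ::ᵥ v.tail)) := by
  let M := lam (lam (app (app (app Z (app combFst (var 0))) (app F (app combSnd (var 0))))
    (app G (app (app combPair (app P (app combFst (var 0))))
      (app (app combPair (app (var 1) (app (app combPair (app P (app combFst (var 0))))
        (app combSnd (var 0))))) (app combSnd (var 0)))))))
  have hM : M.Closed := by
    have hF (i : ℕ) : ¬ FreeIn i F := hF.1 i
    have hG (i : ℕ) : ¬ FreeIn i G := hG.1 i
    have hZ (i : ℕ) : ¬ FreeIn i Z := h.closed_isZero i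
    have hP (i : ℕ) : ¬ FreeIn i P := h.closed_pred i
    have h₁ (i : ℕ) : ¬ FreeIn i combFst := closed_combFst i
    have h₂ (i : ℕ) : ¬ FreeIn i combSnd := closed_combSnd i
    have h₃ (i : ℕ) : ¬ FreeIn i combPair := closed_combPair i
    simp [M, Closed, FreeIn, hF, hG, hZ, hP, h₁, h₂, h₃]
  obtain ⟨R, hR, hRM⟩ := exists_fixedPoint hM
  -- The recursion equation of `R`: the component `combFst A` is the recursion variable, `combSnd A`
  -- the tuple of parameters.
  have hRA (A : LTerm) : BetaEq (app R A)
      (app (app (app Z (app combFst A)) (app F (app combSnd A)))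
        (app G (app (app combPair (app P (app combFst A)))
          (app (app combPair (app R (app (app combPair (app P (app combFst A)))
            (app combSnd A)))) (app combSnd A))))) := by
    refine (hRM.app_left A).trans
      (BetaEq.trans (BetaEq.app_left (BetaEq.of_subst rfl) A) (BetaEq.of_subst ?_))
    simp [subst, hF.1.subst, hG.1.subst, h.closed_isZero.subst, h.closed_pred.subst,
      closed_combFst.subst, closed_combSnd.subst, closed_combPair.subst, hR.rename, hR.subst]
  refine ⟨R, hR, fun v m hm => ?_⟩
  obtain rfl := Part.mem_some_iff.1 hm
  rw [← List.Vector.cons_head_tail v]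
  generalize v.head = y, v.tail = u
  have ht := closed_tuple h.closed u.toList
  simp only [List.Vector.toList_cons, List.Vector.head_cons, List.Vector.tail_cons, tuple]
  induction y with
  | zero =>
    refine (hRA _).trans ?_
    have h₁ := (BetaEq.app_right Z (combFst_app (h.closed 0) ht)).trans h.isZero_zero
    have h₂ := (BetaEq.app_right F (combSnd_app (h.closed 0) ht)).trans (hF.2 u _ (Part.mem_some _))
    exact ((h₁.app h₂).app_left _).trans (combTrue_app _ (h.closed _))
  | succ y ih =>
    refine (hRA _).trans ?_
    have h₁ := (BetaEq.app_right Z (combFst_app (h.closed (y + 1)) ht)).trans (h.isZero_succ y)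
    have h₂ := (BetaEq.app_right P (combFst_app (h.closed (y + 1)) ht)).trans (h.pred_app y)
    have h₃ := combSnd_app (h.closed (y + 1)) ht
    have h₄ := ((BetaEq.app_right combPair h₂).app h₃).trans (combPair_app (h.closed y) ht)
    have h₅ := (BetaEq.app_right R h₄).trans ih
    have h₆ := ((BetaEq.app_right combPair h₅).app h₃).trans (combPair_app (h.closed _) ht)
    have h₇ := ((BetaEq.app_right combPair h₂).app h₆).trans
      (combPair_app (h.closed y) (closed_mkPair (h.closed _) ht))
    refine (((h₁.app_left _).app_left _).trans (combFalse_app _ _)).trans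
      ((BetaEq.app_right G h₇).trans ?_)
    exact hG.2 (y ::ᵥ _ ::ᵥ u) _ (Part.mem_some _)

/-- `R` tests the candidate in the first component and, on a nonzero value, calls itself on the
successor. Started at `d 0`, it passes every candidate below the least zero `m` and stops there.
Where no zero exists nothing is required. -/
theorem exists_represents_rfind (h : AdequateSystem d S P Z) {n : ℕ} {F : LTerm}
    {f : List.Vector ℕ (n + 1) → ℕ} (hF : Represents d F fun v => Part.some (f v)) :
    ∃ R, Represents d R fun v : List.Vector ℕ n =>
      Nat.rfind fun y => Part.some (decide (f (y ::ᵥ v) = 0)) := by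
  let M := lam (lam (app (app (app Z (app F (var 0))) (app combFst (var 0)))
    (app (var 1) (app (app combPair (app S (app combFst (var 0)))) (app combSnd (var 0))))))
  have hM : M.Closed := by
    have hF (i : ℕ) : ¬ FreeIn i F := hF.1 i
    have hZ (i : ℕ) : ¬ FreeIn i Z := h.closed_isZero i
    have hS (i : ℕ) : ¬ FreeIn i S := h.closed_succ i
    have h₁ (i : ℕ) : ¬ FreeIn i combFst := closed_combFst i
    have h₂ (i : ℕ) : ¬ FreeIn i combSnd := closed_combSnd i
    have h₃ (i : ℕ) : ¬ FreeIn i combPair := closed_combPair i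
    simp [M, Closed, FreeIn, hF, hZ, hS, h₁, h₂, h₃]
  obtain ⟨R, hR, hRM⟩ := exists_fixedPoint hM
  have hRA (A : LTerm) : BetaEq (app R A)
      (app (app (app Z (app F A)) (app combFst A))
        (app R (app (app combPair (app S (app combFst A))) (app combSnd A)))) := by
    refine (hRM.app_left A).trans
      (BetaEq.trans (BetaEq.app_left (BetaEq.of_subst rfl) A) (BetaEq.of_subst ?_))
    simp [subst, hF.1.subst, h.closed_isZero.subst, h.closed_succ.subst,
      closed_combFst.subst, closed_combSnd.subst, closed_combPair.subst, hR.rename, hR.subst]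
  refine ⟨LTerm.comp R (app combPair (d 0)),
    closed_comp hR (closed_combPair.app (h.closed 0)), fun v m hm => ?_⟩
  have ht := closed_tuple h.closed v.toList
  refine (comp_app hR (closed_combPair.app (h.closed 0)) _).trans
    ((BetaEq.app_right R (combPair_app (h.closed 0) ht)).trans ?_)
  obtain ⟨hm, hlt⟩ := Nat.mem_rfind.1 hm
  have hm : f (m ::ᵥ v) = 0 := by simpa using hm
  have hF' (y : ℕ) : BetaEq (app F (mkPair (d y) (tuple d v.toList))) (d (f (y ::ᵥ v))) :=
    hF.2 (y ::ᵥ v) _ (Part.mem_some _)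
  have hstep (y : ℕ) (hy : y < m) : BetaEq (app R (mkPair (d y) (tuple d v.toList)))
      (app R (mkPair (d (y + 1)) (tuple d v.toList))) := by
    obtain ⟨c, hc⟩ : ∃ c, f (y ::ᵥ v) = c + 1 :=
      Nat.exists_eq_succ_of_ne_zero (by simpa using hlt hy)
    have h₁ := hF' y
    rw [hc] at h₁
    have h₂ := (BetaEq.app_right Z h₁).trans (h.isZero_succ c)
    have h₃ := (BetaEq.app_right S (combFst_app (h.closed y) ht)).trans (h.succ_app y)
    have h₄ := ((BetaEq.app_right combPair h₃).app (combSnd_app (h.closed y) ht)).trans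
      (combPair_app (h.closed (y + 1)) ht)
    exact (hRA _).trans ((((h₂.app_left _).app_left _).trans (combFalse_app _ _)).trans
      (BetaEq.app_right R h₄))
  have hreach (y : ℕ) (hy : y ≤ m) : BetaEq (app R (mkPair (d 0) (tuple d v.toList)))
      (app R (mkPair (d y) (tuple d v.toList))) := by
    induction y with
    | zero => exact .refl _
    | succ y ih => exact (ih (by omega)).trans (hstep y hy)
  have h₁ := hF' m
  rw [hm] at h₁
  have h₂ := (BetaEq.app_right Z h₁).trans h.isZero_zero
  have h₃ := combFst_app (h.closed m) ht
  exact (hreach m le_rfl).trans ((hRA _).trans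
    (((h₂.app h₃).app_left _).trans (combTrue_app _ (h.closed m))))

theorem exists_represents_primrec (h : AdequateSystem d S P Z) {n : ℕ}
    {f : List.Vector ℕ n → ℕ} (hf : Nat.Primrec' f) :
    ∃ F, Represents d F fun v => Part.some (f v) := by
  induction hf with
  | zero =>
    refine ⟨lam (d 0), closed_lam (h.closed 0), fun v m hm => ?_⟩
    obtain rfl := Part.mem_some_iff.1 hm
    exact closed_lam_app (h.closed 0) _
  | succ =>
    refine ⟨LTerm.comp S combFst, closed_comp h.closed_succ closed_combFst, fun v m hm => ?_⟩
    obtain rfl := Part.mem_some_iff.1 hm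
    rw [← List.Vector.cons_head_tail v]
    exact (comp_app h.closed_succ closed_combFst _).trans
      ((BetaEq.app_right S (combFst_app (h.closed _) (closed_tuple h.closed _))).trans
        (h.succ_app _))
  | get i => exact exists_represents_get h.closed i
  | comp g _ _ ihf ihg =>
    obtain ⟨F, hF⟩ := ihf
    obtain ⟨H, hH⟩ := hF.comp h.closed _ ihg
    refine ⟨H, hH.1, fun v m hm => hH.2 v m ?_⟩
    -- For total `g i` the monadic vector of values is a pure value, so partial composition reduces
    -- to ordinary composition.
    have := List.Vector.mOfFn_pure (m := Part) fun i => g i v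
    simp only [Part.pure_eq_some] at this
    simpa [this] using hm
  | prec _ _ ihf ihg =>
    obtain ⟨F, hF⟩ := ihf
    obtain ⟨G, hG⟩ := ihg
    exact h.exists_represents_prec hF hG

theorem exists_represents_partrec (h : AdequateSystem d S P Z) {n : ℕ}
    {f : List.Vector ℕ n →. ℕ} (hf : Nat.Partrec' f) : ∃ F, Represents d F f := by
  induction hf with
  | prim hf => exact h.exists_represents_primrec hf
  | comp g _ _ ihf ihg =>
    obtain ⟨F, hF⟩ := ihf
    exact hF.comp h.closed g ihg
  | rfind _ ihf =>
    obtain ⟨F, hF⟩ := ihf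
    exact h.exists_represents_rfind hF

theorem lambdaDefinable (h : AdequateSystem d S P Z) {p : ℕ} {φ : (Fin p → ℕ) → ℕ}
    (hφ : Computable φ) : LambdaDefinable d φ := by
  have hφ' : Partrec fun v : List.Vector ℕ p => Part.some (φ v.get) :=
    hφ.comp Primrec.vector_get'.to_comp
  obtain ⟨F, hF, hF'⟩ := h.exists_represents_partrec (Nat.Partrec'.of_part hφ')
  refine ⟨app (combCurry p) F, fun n => ?_⟩
  have h₁ := combCurry_appList h.closed hF (List.ofFn n)
  rw [List.length_ofFn, List.map_ofFn] at h₁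
  refine h₁.trans ?_
  have h₂ := hF' (List.Vector.ofFn n) (φ n) (by
    have : (List.Vector.ofFn n).get = n := funext (List.Vector.get_ofFn n)
    simp [this])
  rwa [List.Vector.toList_ofFn] at h₂

end AdequateSystem

/-! ### From `k` to successor, predecessor and zero test -/

theorem exists_closed_of_lambdaDefinable₂ {d : ℕ → LTerm} (hd : ∀ n, (d n).Closed)
    {k : ℕ → ℕ → ℕ} (hk : LambdaDefinable d fun v : Fin 2 → ℕ => k (v 0) (v 1)) :
    ∃ K : LTerm, K.Closed ∧ ∀ n m, BetaEq (app (app K (d n)) (d m)) (d (k n m)) := by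
  obtain ⟨K, hK⟩ := hk
  refine ⟨K.subst fun _ => combI, closed_subst (fun _ => closed_combI) K, fun n m => ?_⟩
  have h := (hK ![n, m]).subst fun _ => combI
  simpa [List.ofFn_succ, subst, (hd _).subst] using h

theorem exists_adequateSystem {d : ℕ → LTerm} (hd : IsNumeralSystem d) {k : ℕ → ℕ → ℕ}
    (hk₀ : ∀ n, k n 0 = n + 1) (hk₁ : ∀ n, k (n + 1) 1 = n) (hk : ∀ n, k (n + 1) (n + 1) = 0)
    (hdef : LambdaDefinable d fun v : Fin 2 → ℕ => k (v 0) (v 1)) :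
    ∃ S P Z, AdequateSystem d S P Z := by
  obtain ⟨K, hK, hKd⟩ := exists_closed_of_lambdaDefinable₂ hd.closed hdef
  -- The order matters: `d 1` goes to true, because the diagonal takes the value `1` exactly at `0`.
  obtain ⟨l, hl, h₁, h₀⟩ := separable_of_ne (hd.normal 1) (hd.normal 0) (hd.closed 1)
    (hd.closed 0) (hd.injective.ne Nat.one_ne_zero) _ _ closed_combTrue closed_combFalse
  have hKf (i : ℕ) : ¬ FreeIn i K := hK i
  have apply_right (i : ℕ) :
      (lam (app (app K (var 0)) (d i))).Closed ∧
        ∀ n, BetaEq (app (lam (app (app K (var 0)) (d i))) (d n)) (d (k n i)) := by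
    have hdf (j : ℕ) : ¬ FreeIn j (d i) := hd.closed i j
    refine ⟨by simp [Closed, FreeIn, hKf, hdf], fun n => ?_⟩
    exact BetaEq.trans (.of_subst (by simp [subst, hK.subst, (hd.closed i).subst])) (hKd n i)
  -- The zero test `λx. K x x` followed by the separating arguments `l`.
  have happ : (lam ((app (app K (var 0)) (var 0)).appList l)).Closed := fun i hi => by
    simpa [FreeIn, hKf] using freeIn_appList hl hi
  have hdiag (n : ℕ) : BetaEq (app (lam ((app (app K (var 0)) (var 0)).appList l)) (d n))
      ((d (k n n)).appList l) := by
    refine BetaEq.trans (.of_subst ?_) ((hKd n n).appList l)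
    rw [subst_appList, List.map_congr_left fun A hA => (hl A hA).subst _, List.map_id']
    simp [subst, hK.subst]
  refine ⟨_, _, _, hd.closed, (apply_right 0).1, (apply_right 1).1, happ, fun n => ?_, fun n => ?_,
    ?_, fun n => ?_⟩
  · simpa only [hk₀] using (apply_right 0).2 n
  · simpa only [hk₁] using (apply_right 1).2 (n + 1)
  · have h := hdiag 0
    rw [hk₀] at h
    exact h.trans h₁
  · have h := hdiag (n + 1)
    rw [hk] at h
    exact h.trans h₀

theorem computable_succ_or_dist :
    Computable fun v : Fin 2 → ℕ => if v 1 = 0 then v 0 + 1 else (v 0 - v 1) + (v 1 - v 0) := by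
  have h (i : Fin 2) : Primrec fun v : Fin 2 → ℕ => v i :=
    Primrec.fin_app.comp Primrec.id (Primrec.const i)
  refine Primrec.to_comp ?_
  exact Primrec.ite (Primrec.eq.comp (h 1) (Primrec.const 0)) (Primrec.succ.comp (h 0))
    (Primrec.nat_add.comp (Primrec.nat_sub.comp (h 0) (h 1)) (Primrec.nat_sub.comp (h 1) (h 0)))

theorem theorem5 :
    ∃ k : ℕ → ℕ → ℕ,
      (∀ n : ℕ, k n 0 = n + 1) ∧
      (∀ n m : ℕ, m ≠ 0 → (k n m : ℤ) = |(n : ℤ) - (m : ℤ)|) ∧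
      ∀ d : ℕ → LTerm, IsNumeralSystem d →
        (LambdaDefinable d (fun v : Fin 2 → ℕ => k (v 0) (v 1)) ↔
          ∀ (p : ℕ) (φ : (Fin p → ℕ) → ℕ), Computable φ → LambdaDefinable d φ) := by
  -- The distance is a sum of two truncated differences, at least one of which is zero.
  refine ⟨fun n m => if m = 0 then n + 1 else (n - m) + (m - n), fun n => by simp,
    fun n m hm => ?_, fun d hd => ⟨fun hdef p φ hφ => ?_, fun h => h 2 _ computable_succ_or_dist⟩⟩
  · simp only [if_neg hm]
    rcases abs_cases ((n : ℤ) - m) with ⟨h, _⟩ | ⟨h, _⟩ <;> omega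
  · obtain ⟨S, P, Z, hA⟩ := exists_adequateSystem hd
      (k := fun n m => if m = 0 then n + 1 else (n - m) + (m - n)) (fun n => by simp) (fun n => by simp)
      (fun n => by simp) hdef
    exact hA.lambdaDefinable hφ
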